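/- Let $\frac13<\alpha<1$, let $\mathbb D$ be the open unit disk, and let $$\varphi(z)=\left(\frac{z+\alpha}{1+\alpha z}\right)^2 ,$$ which maps $\mathbb D$ into $\mathbb D$ and is a Blaschke product of degree $2$, with a single zero, at its critical point $-\alpha$, of multiplicity $2$. Let $$\mathcal Z_0=\{\zeta\in\mathbb D:\ \varphi^{[n]}(\zeta)=\varphi^{[m]}(0)\text{ for some integers } n,m\ge 0\}$$ be the grand orbit of $0$, where $\varphi^{[n]}$ is the $n$-th iterate of $\varphi$, and let $$\mathcal M_2=\{z\in\mathcal Z_0:\ \varphi^{[n]}(z)=-\alpha\text{ for some } n\ge 0\},\qquad \mathcal M_1=\mathcal Z_0\setminus\mathcal M_2 .$$ Then there is a Blaschke product $B$ on $\mathbb D$ whose zero set is exactly $\mathcal Z_0$, the zeros in $\mathcal M_2$ having multiplicity $2$ and those in $\mathcal M_1$ multiplicity $1$ (in particular, these zeros, counted with multiplicity, satisfy the Blaschke condition), such that $$B\circ\varphi=-B\quad\text{on }\mathbb D,\qquad\text{and hence}\qquad B^2\circ\varphi=B^2\quad\text{on }\mathbb D .$$ -/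

import Mathlib

/-- The Blaschke factor with its zero at `a`, normalised to be positive at `0` when `a ≠ 0`. -/
noncomputable def blaschkeFactor (a z : ℂ) : ℂ :=
  if a = 0 then z
  else (starRingEnd ℂ a / (‖a‖ : ℂ)) * ((a - z) / (1 - starRingEnd ℂ a * z))

/-- `B` is, on the open unit disk, a (finite or infinite) Blaschke product in which each point `a`
of the disk is taken as a zero with multiplicity `m a`: the Blaschke condition holds, and `B` is a
unimodular constant times the (unconditionally convergent) product of the corresponding factors.
The values of `B` outside the disk are irrelevant. -/
def IsBlaschkeProduct (m : ℂ → ℕ) (B : ℂ → ℂ) : Prop :=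
  (∀ a : ℂ, m a ≠ 0 → a ∈ Metric.ball (0 : ℂ) 1) ∧
  (Summable fun a : ℂ => (m a : ℝ) * (1 - ‖a‖)) ∧
  ∃ c : ℂ, ‖c‖ = 1 ∧ ∀ z ∈ Metric.ball (0 : ℂ) 1, ∃ p : ℂ,
    HasProd (fun a : ℂ => blaschkeFactor a z ^ m a) p ∧ B z = c * p

/-- The grand orbit of `z₀` in the open unit disk under `φ`. -/
def grandOrbit (φ : ℂ → ℂ) (z₀ : ℂ) : Set ℂ :=
  {ζ | ζ ∈ Metric.ball (0 : ℂ) 1 ∧ ∃ n m : ℕ, φ^[n] ζ = φ^[m] z₀}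

/-- The map `z ↦ ((z + α) / (1 + α z))²`. -/
noncomputable def phiMap (α : ℝ) (z : ℂ) : ℂ :=
  ((z + (α : ℂ)) / (1 + (α : ℂ) * z)) ^ 2

/-- The points of the grand orbit of `0` whose forward orbit (starting with the point itself)
hits the critical point `-α`. -/
def doubleZeros (α : ℝ) : Set ℂ :=
  {z | z ∈ grandOrbit (phiMap α) 0 ∧ ∃ n : ℕ, (phiMap α)^[n] z = -(α : ℂ)}

/-- The remaining points of the grand orbit of `0`. -/
def simpleZeros (α : ℝ) : Set ℂ :=
  grandOrbit (phiMap α) 0 \ doubleZeros α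

open Classical in
/-- Multiplicity `2` on `doubleZeros α`, `1` on `simpleZeros α`, and `0` elsewhere. -/
noncomputable def zeroMult (α : ℝ) (z : ℂ) : ℕ :=
  if z ∈ doubleZeros α then 2 else if z ∈ simpleZeros α then 1 else 0

/-!
Write `φ` for `phiMap α`, `b_a` for the Blaschke factor with zero `a`, `m` for `zeroMult α` and `B`
for the Blaschke product with zeros `m`. Since `φ` is the square of a disk automorphism, it is a
double cover of the disk branched only over `0 = φ (-α)`, and `|b_a ∘ φ|` is the product of the
`|b_c|` over the two points `c` of the fibre of `a` (`norm_blaschkeFactor_phiMap`).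

The Blaschke condition is `blaschkeCondition_zeroMult`. For `1 / 3 < α` the point `1` is an
attracting fixed point, and the critical orbit `w_n = φ^[n] 0` tends to it geometrically
(`one_sub_critOrbit_le`). Let `y_k ∈ (-1, -α]` be the preimage of `w_k` on the other side of the
origin. The grand orbit consists of the `w_k` and of the points that some `φ^[n]` maps to some `y_k`
(`mem_critOrbit_or_reaches_sidePreimage`). Iterating the factorisation of `|b_a ∘ φ|` gives
`∑ -log |c| ≤ ∑_k -log |b_{y_k} (w_n)|`, where `c` runs through the preimages in the disk
of the `y_k` under `φ^[n]` (`greenPotential_preimage_iterate_le`). As the `y_k` and the `w_n` lie on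
opposite sides of the origin, the right-hand side is bounded by a double geometric series in `k` and
`n`.

The multiplicities are such that `m c` is `m (φ c)` times the local degree of `φ` at `c`. Regrouping
the product `|B|` along the fibres of `φ` therefore yields `|B ∘ φ| = |B|`
(`norm_blaschkeProd_phiMap`), so `B ∘ φ = κ B` with a unimodular constant `κ`. Finally, `B` is real
on the real axis, and between a point of `(0, w_1)` and its image in `(w_1, w_2)` it has exactly one
zero, the simple one at `w_1`. Hence `κ` is negative
(`exists_blaschkeProd_phiMap_eq_neg_mul`), which forces `κ = -1`.
-/

open Filter Topology ComplexConjugate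
open scoped ENNReal

/-! ### Blaschke factors -/

theorem one_sub_conj_mul_ne_zero {a z : ℂ} (ha : ‖a‖ < 1) (hz : ‖z‖ < 1) :
    1 - conj a * z ≠ 0 := by
  intro h
  have h1 : ‖conj a * z‖ = 1 := by rw [← sub_eq_zero.mp h, norm_one]
  rw [norm_mul, Complex.norm_conj] at h1
  nlinarith [norm_nonneg a, norm_nonneg z]

theorem norm_blaschkeFactor (a z : ℂ) :
    ‖blaschkeFactor a z‖ = ‖(a - z) / (1 - conj a * z)‖ := by
  unfold blaschkeFactor
  split_ifs with h
  · simp [h]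
  · have : ‖a‖ ≠ 0 := norm_ne_zero_iff.mpr h
    rw [norm_mul, norm_div, Complex.norm_conj, Complex.norm_real, norm_norm, div_self this, one_mul]

theorem norm_blaschkeFactor_zero_right (a : ℂ) : ‖blaschkeFactor a 0‖ = ‖a‖ := by
  simp [norm_blaschkeFactor]

theorem blaschkeFactor_eq_zero_iff {a z : ℂ} (ha : ‖a‖ < 1) (hz : ‖z‖ < 1) :
    blaschkeFactor a z = 0 ↔ z = a := by
  rw [← norm_eq_zero, norm_blaschkeFactor, norm_eq_zero, div_eq_zero_iff,
    or_iff_left (one_sub_conj_mul_ne_zero ha hz), sub_eq_zero, eq_comm]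

/-- The defect of a Blaschke factor from being unimodular. -/
theorem one_sub_norm_blaschkeFactor_sq {a z : ℂ} (ha : ‖a‖ < 1) (hz : ‖z‖ < 1) :
    1 - ‖blaschkeFactor a z‖ ^ 2 =
      (1 - ‖a‖ ^ 2) * (1 - ‖z‖ ^ 2) / ‖1 - conj a * z‖ ^ 2 := by
  have h : ‖1 - conj a * z‖ ^ 2 ≠ 0 := by
    simpa using one_sub_conj_mul_ne_zero ha hz
  rw [norm_blaschkeFactor, norm_div, div_pow, eq_div_iff h, sub_mul, div_mul_cancel₀ _ h]
  simp only [Complex.sq_norm, Complex.normSq_apply, Complex.sub_re, Complex.sub_im, Complex.mul_re,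
    Complex.mul_im, Complex.one_re, Complex.one_im, Complex.conj_re, Complex.conj_im]
  ring

theorem norm_blaschkeFactor_lt_one {a z : ℂ} (ha : ‖a‖ < 1) (hz : ‖z‖ < 1) :
    ‖blaschkeFactor a z‖ < 1 := by
  have h := one_sub_norm_blaschkeFactor_sq ha hz
  have h2 : 0 < (1 - ‖a‖ ^ 2) * (1 - ‖z‖ ^ 2) / ‖1 - conj a * z‖ ^ 2 := by
    have h3 : 0 < 1 - ‖a‖ ^ 2 := by nlinarith [norm_nonneg a]
    have h4 : 0 < 1 - ‖z‖ ^ 2 := by nlinarith [norm_nonneg z]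
    have h5 := norm_pos_iff.mpr (one_sub_conj_mul_ne_zero ha hz)
    positivity
  nlinarith [norm_nonneg (blaschkeFactor a z)]

theorem norm_blaschkeFactor_sub_one_le {a z : ℂ} {r : ℝ} (ha : ‖a‖ < 1) (hz : ‖z‖ ≤ r)
    (hr : r < 1) : ‖blaschkeFactor a z - 1‖ ≤ 2 / (1 - r) * (1 - ‖a‖) := by
  have hz1 : ‖z‖ < 1 := hz.trans_lt hr
  have hden := one_sub_conj_mul_ne_zero ha hz1
  have h1r : 0 < 1 - r := by linarith
  have ha0 : 0 ≤ 1 - ‖a‖ := by linarith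
  by_cases h : a = 0
  · subst h
    have h1 : ‖z - 1‖ ≤ 2 := (norm_sub_le _ _).trans (by rw [norm_one]; linarith)
    have h2 : 2 ≤ 2 / (1 - r) := by
      rw [le_div_iff₀ h1r]; nlinarith [norm_nonneg z]
    simpa [blaschkeFactor] using h1.trans h2
  · have hn : (‖a‖ : ℂ) ≠ 0 := by simpa using h
    have key : blaschkeFactor a z - 1 =
        -((1 - ‖a‖ : ℝ) : ℂ) * ((1 + conj a / (‖a‖ : ℂ) * z) / (1 - conj a * z)) := by
      have hsq : conj a * a = (‖a‖ : ℂ) ^ 2 := by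
        rw [mul_comm, Complex.mul_conj, Complex.normSq_eq_norm_sq]; norm_cast
      simp only [blaschkeFactor, if_neg h]
      push_cast
      field_simp
      linear_combination hsq
    have hu : ‖conj a / (‖a‖ : ℂ)‖ = 1 := by
      rw [norm_div, Complex.norm_conj, Complex.norm_real, norm_norm,
        div_self (norm_ne_zero_iff.mpr h)]
    have hnum : ‖1 + conj a / (‖a‖ : ℂ) * z‖ ≤ 2 := by
      refine (norm_add_le _ _).trans ?_
      rw [norm_mul, hu, norm_one]; linarith
    have hlow : 1 - r ≤ ‖1 - conj a * z‖ := by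
      have := norm_sub_norm_le (1 : ℂ) (conj a * z)
      rw [norm_one, norm_mul, Complex.norm_conj] at this
      nlinarith [norm_nonneg a, norm_nonneg z]
    rw [key, norm_mul, norm_neg, Complex.norm_real, Real.norm_of_nonneg ha0, norm_div, mul_comm]
    gcongr

theorem norm_pow_sub_one_le {w : ℂ} (hw : ‖w‖ ≤ 1) (n : ℕ) : ‖w ^ n - 1‖ ≤ n * ‖w - 1‖ := by
  rw [← mul_geom_sum w n, norm_mul, mul_comm]
  gcongr
  refine (norm_sum_le _ _).trans ?_
  refine (Finset.sum_le_card_nsmul _ _ 1 fun i _ ↦ ?_).trans (by simp)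
  rw [norm_pow]
  exact pow_le_one₀ (norm_nonneg _) hw

theorem differentiableOn_blaschkeFactor {a : ℂ} (ha : ‖a‖ < 1) :
    DifferentiableOn ℂ (blaschkeFactor a) (Metric.ball 0 1) := by
  intro z hz
  rw [mem_ball_zero_iff] at hz
  have hden := one_sub_conj_mul_ne_zero ha hz
  apply DifferentiableAt.differentiableWithinAt
  unfold blaschkeFactor
  split_ifs with h
  · exact differentiableAt_id
  · fun_prop (disch := exact hden)

theorem analyticAt_blaschkeFactor {a z : ℂ} (ha : ‖a‖ < 1) (hz : ‖z‖ < 1) :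
    AnalyticAt ℂ (blaschkeFactor a) z :=
  (differentiableOn_blaschkeFactor ha).analyticAt
    (Metric.isOpen_ball.mem_nhds (mem_ball_zero_iff.mpr hz))

theorem analyticOrderAt_blaschkeFactor_self {a : ℂ} (ha : ‖a‖ < 1) :
    analyticOrderAt (blaschkeFactor a) a = 1 := by
  have hden := one_sub_conj_mul_ne_zero ha ha
  rw [← Nat.cast_one, (analyticAt_blaschkeFactor ha ha).analyticOrderAt_eq_natCast]
  by_cases h : a = 0
  · exact ⟨fun _ ↦ 1, analyticAt_const, one_ne_zero, by simp [blaschkeFactor, h]⟩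
  · have hn : (‖a‖ : ℂ) ≠ 0 := by simpa using h
    refine ⟨fun z ↦ -(conj a / (‖a‖ : ℂ)) / (1 - conj a * z), ?_, ?_, ?_⟩
    · exact AnalyticAt.div (by fun_prop) (by fun_prop) hden
    · simp [hden, h]
    · refine Eventually.of_forall fun z ↦ ?_
      simp only [blaschkeFactor, if_neg h, smul_eq_mul, pow_one]
      ring

theorem conj_blaschkeFactor (a z : ℂ) :
    conj (blaschkeFactor a z) = blaschkeFactor (conj a) (conj z) := by
  unfold blaschkeFactor
  by_cases h : a = 0 <;> simp [h]

/-! ### Blaschke products -/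

/-- The Blaschke condition for a system of zeros `a` with multiplicities `m a`, all of them in
the open unit disk. -/
structure BlaschkeCondition (m : ℂ → ℕ) : Prop where
  norm_lt_one : ∀ a, m a ≠ 0 → ‖a‖ < 1
  summable : Summable fun a : ℂ => (m a : ℝ) * (1 - ‖a‖)

/-- The Blaschke product with zeros of multiplicity `m a` at `a` and with unimodular constant `1`;
on the disk the infinite product converges unconditionally. -/
noncomputable def blaschkeProd (m : ℂ → ℕ) (z : ℂ) : ℂ := ∏' a, blaschkeFactor a z ^ m a

namespace BlaschkeCondition

variable {m m' : ℂ → ℕ}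

theorem norm_sub_one_le (hm : BlaschkeCondition m) {z : ℂ} {r : ℝ} (hz : ‖z‖ ≤ r) (hr : r < 1)
    (a : ℂ) : ‖blaschkeFactor a z ^ m a - 1‖ ≤ 2 / (1 - r) * ((m a : ℝ) * (1 - ‖a‖)) := by
  by_cases h : m a = 0
  · simp [h]
  · have ha := hm.norm_lt_one a h
    calc _ ≤ m a * ‖blaschkeFactor a z - 1‖ :=
          norm_pow_sub_one_le (norm_blaschkeFactor_lt_one ha (hz.trans_lt hr)).le _
      _ ≤ m a * (2 / (1 - r) * (1 - ‖a‖)) := by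
          gcongr; exact norm_blaschkeFactor_sub_one_le ha hz hr
      _ = _ := by ring

theorem differentiableOn_factor (hm : BlaschkeCondition m) (a : ℂ) :
    DifferentiableOn ℂ (fun z ↦ blaschkeFactor a z ^ m a) (Metric.ball 0 1) := by
  by_cases h : m a = 0
  · simp [h]
  · exact (differentiableOn_blaschkeFactor (hm.norm_lt_one a h)).pow _

theorem hasProdLocallyUniformlyOn (hm : BlaschkeCondition m) :
    HasProdLocallyUniformlyOn (fun a z ↦ blaschkeFactor a z ^ m a) (blaschkeProd m)
      (Metric.ball 0 1) := by
  refine hasProdLocallyUniformlyOn_of_of_forall_exists_nhds fun z hz ↦ ?_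
  rw [mem_ball_zero_iff] at hz
  obtain ⟨r, hzr, hr⟩ := exists_between hz
  refine ⟨Metric.closedBall 0 r, mem_nhdsWithin_of_mem_nhds
    (Metric.closedBall_mem_nhds_of_mem (mem_ball_zero_iff.mpr hzr)), ?_⟩
  have := (hm.summable.mul_left (2 / (1 - r))).hasProdUniformlyOn_one_add
    (f := fun a z ↦ blaschkeFactor a z ^ m a - 1) (isCompact_closedBall 0 r)
    (Eventually.of_forall fun a z hz ↦ hm.norm_sub_one_le (mem_closedBall_zero_iff.mp hz) hr a)
    (fun a ↦ ((hm.differentiableOn_factor a).continuousOn.mono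
      (Metric.closedBall_subset_ball hr)).sub continuousOn_const)
  simp only [add_sub_cancel] at this
  exact this

theorem hasProd (hm : BlaschkeCondition m) {z : ℂ} (hz : ‖z‖ < 1) :
    HasProd (fun a ↦ blaschkeFactor a z ^ m a) (blaschkeProd m z) :=
  hm.hasProdLocallyUniformlyOn.hasProd (mem_ball_zero_iff.mpr hz)

theorem analyticOnNhd (hm : BlaschkeCondition m) :
    AnalyticOnNhd ℂ (blaschkeProd m) (Metric.ball 0 1) := by
  refine DifferentiableOn.analyticOnNhd ?_ Metric.isOpen_ball
  refine (hasProdLocallyUniformlyOn_iff_tendstoLocallyUniformlyOn.mp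
    hm.hasProdLocallyUniformlyOn).differentiableOn (Eventually.of_forall fun s ↦ ?_)
    Metric.isOpen_ball
  exact DifferentiableOn.fun_finsetProd fun a _ ↦ hm.differentiableOn_factor a

theorem blaschkeProd_ne_zero (hm : BlaschkeCondition m) {z : ℂ} (hz : ‖z‖ < 1) (h : m z = 0) :
    blaschkeProd m z ≠ 0 := by
  have := tprod_one_add_ne_zero_of_summable (f := fun a ↦ blaschkeFactor a z ^ m a - 1) ?_ ?_
  · simp only [add_sub_cancel] at this
    exact this
  · intro a
    rw [add_sub_cancel]
    by_cases ha : m a = 0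
    · simp [ha]
    · refine pow_ne_zero _ ?_
      rw [Ne, blaschkeFactor_eq_zero_iff (hm.norm_lt_one a ha) hz]
      rintro rfl
      exact ha h
  · exact (hm.summable.mul_left _).of_nonneg_of_le (fun _ ↦ norm_nonneg _)
      (fun a ↦ hm.norm_sub_one_le le_rfl hz a)

/-- Discarding the zero at `a`. -/
theorem update_zero (hm : BlaschkeCondition m) (a : ℂ) :
    BlaschkeCondition (Function.update m a 0) where
  norm_lt_one b hb := by
    by_cases h : b = a
    · simp [h] at hb
    · rw [Function.update_of_ne h] at hb
      exact hm.norm_lt_one b hb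
  summable := by
    refine (hm.summable.update a 0).congr fun b ↦ ?_
    by_cases h : b = a
    · simp [h]
    · simp [Function.update_of_ne h]

theorem blaschkeProd_eq_mul (hm : BlaschkeCondition m) (a : ℂ) {z : ℂ} (hz : ‖z‖ < 1) :
    blaschkeProd m z = blaschkeFactor a z ^ m a * blaschkeProd (Function.update m a 0) z := by
  have h1 := (hasProd_ite_eq a (blaschkeFactor a z ^ m a)).mul ((hm.update_zero a).hasProd hz)
  refine (hm.hasProd hz).unique (h1.congr_fun ?_)
  intro b
  by_cases h : b = a
  · simp [h]
  · simp [h]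

theorem analyticOrderAt_blaschkeProd (hm : BlaschkeCondition m) {z : ℂ} (hz : ‖z‖ < 1) :
    analyticOrderAt (blaschkeProd m) z = m z := by
  have hz' : z ∈ Metric.ball (0 : ℂ) 1 := mem_ball_zero_iff.mpr hz
  have hm' := hm.update_zero z
  have hb := analyticAt_blaschkeFactor hz hz
  have heq : blaschkeProd m =ᶠ[𝓝 z]
      blaschkeFactor z ^ m z * blaschkeProd (Function.update m z 0) := by
    filter_upwards [Metric.isOpen_ball.mem_nhds hz'] with w hw
    exact hm.blaschkeProd_eq_mul z (mem_ball_zero_iff.mp hw)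
  rw [analyticOrderAt_congr heq, analyticOrderAt_mul (hb.pow _) (hm'.analyticOnNhd z hz'),
    analyticOrderAt_pow hb, analyticOrderAt_blaschkeFactor_self hz,
    analyticOrderAt_eq_zero.mpr (Or.inr (hm'.blaschkeProd_ne_zero hz (by simp)))]
  simp

/-- A Blaschke product with conjugation-invariant zeros is real on the real axis. -/
theorem conj_blaschkeProd_ofReal (hm : BlaschkeCondition m) (hc : ∀ a, m (conj a) = m a) {x : ℝ}
    (hx : ‖(x : ℂ)‖ < 1) : conj (blaschkeProd m x) = blaschkeProd m x := by
  have h1 := (hm.hasProd hx).map (starRingEnd ℂ) Complex.continuous_conj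
  have h2 := (Equiv.hasProd_iff (starRingAut (R := ℂ)).toEquiv).mpr (hm.hasProd hx)
  refine h1.unique (h2.congr_fun fun a ↦ ?_)
  simp [conj_blaschkeFactor, ← hc a]

end BlaschkeCondition

/-! ### The disk automorphisms `mobius` and the fibres of `phiMap` -/

/-- The automorphism `z ↦ (z + α) / (1 + α z)` of the disk, for real `α ∈ (-1, 1)`; its inverse is
`mobius (-α)`. -/
noncomputable def mobius (α : ℝ) (z : ℂ) : ℂ := (z + α) / (1 + α * z)

theorem phiMap_eq_mobius_sq (α : ℝ) (z : ℂ) : phiMap α z = mobius α z ^ 2 := rfl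

theorem one_add_ofReal_mul_ne_zero {α : ℝ} (hα : |α| < 1) {z : ℂ} (hz : ‖z‖ < 1) :
    1 + (α : ℂ) * z ≠ 0 := by
  have := one_sub_conj_mul_ne_zero (a := ((-α : ℝ) : ℂ)) (by simpa using hα) hz
  simpa using this

theorem norm_mobius_lt_one {α : ℝ} (hα : |α| < 1) {z : ℂ} (hz : ‖z‖ < 1) : ‖mobius α z‖ < 1 := by
  have := norm_blaschkeFactor_lt_one (a := ((-α : ℝ) : ℂ)) (by simpa using hα) hz
  rw [norm_blaschkeFactor] at this
  convert this using 1
  rw [mobius, ← norm_neg, ← neg_div]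
  congr 2
  · push_cast; ring
  · simp

theorem mobius_neg_mobius {α : ℝ} (hα : |α| < 1) {z : ℂ} (hz : ‖z‖ < 1) :
    mobius (-α) (mobius α z) = z := by
  have h1 := one_add_ofReal_mul_ne_zero hα hz
  have h2 := one_add_ofReal_mul_ne_zero (α := -α) (by simpa using hα) (norm_mobius_lt_one hα hz)
  have h3 : mobius α z * (1 + α * z) = z + α := div_mul_cancel₀ _ h1
  rw [mobius, div_eq_iff h2]
  push_cast
  linear_combination h3

theorem mobius_mobius_neg {α : ℝ} (hα : |α| < 1) {z : ℂ} (hz : ‖z‖ < 1) :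
    mobius α (mobius (-α) z) = z := by
  simpa using mobius_neg_mobius (α := -α) (by simpa using hα) hz

theorem mobius_inj {α : ℝ} (hα : |α| < 1) {z w : ℂ} (hz : ‖z‖ < 1) (hw : ‖w‖ < 1)
    (h : mobius α z = mobius α w) : z = w := by
  rw [← mobius_neg_mobius hα hz, h, mobius_neg_mobius hα hw]

theorem conj_mobius (α : ℝ) (z : ℂ) : conj (mobius α z) = mobius α (conj z) := by
  simp [mobius]

/-- The pseudo-hyperbolic distance is invariant under `mobius α`. -/
theorem norm_blaschkeFactor_mobius {α : ℝ} (hα : |α| < 1) {c z : ℂ} (hc : ‖c‖ < 1) (hz : ‖z‖ < 1) :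
    ‖blaschkeFactor (mobius α c) (mobius α z)‖ = ‖blaschkeFactor c z‖ := by
  have h1 := one_add_ofReal_mul_ne_zero hα hz
  have h2 := one_add_ofReal_mul_ne_zero hα hc
  have h3 := one_add_ofReal_mul_ne_zero hα (z := conj c) (by simpa using hc)
  have h4 := one_sub_conj_mul_ne_zero hc hz
  have h5 := one_sub_conj_mul_ne_zero (norm_mobius_lt_one hα hc) (norm_mobius_lt_one hα hz)
  have h6 : (1 : ℂ) - (α : ℂ) ^ 2 ≠ 0 := by
    have : (1 : ℝ) - α ^ 2 ≠ 0 := by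
      have := (sq_lt_one_iff_abs_lt_one α).mpr hα
      linarith
    exact_mod_cast this
  have e1 : mobius α c - mobius α z =
      (1 - (α : ℂ) ^ 2) * (c - z) / ((1 + α * c) * (1 + α * z)) := by
    rw [mobius, mobius, div_sub_div _ _ h2 h1]; congr 1; ring
  have e2 : 1 - conj (mobius α c) * mobius α z =
      (1 - (α : ℂ) ^ 2) * (1 - conj c * z) / ((1 + α * conj c) * (1 + α * z)) := by
    rw [conj_mobius, mobius, mobius, div_mul_div_comm, one_sub_div (mul_ne_zero h3 h1)]
    congr 1; ring
  have e3 : ‖1 + (α : ℂ) * conj c‖ = ‖1 + (α : ℂ) * c‖ := by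
    rw [← Complex.norm_conj]; simp
  have h2' := norm_ne_zero_iff.mpr h2
  have h1' := norm_ne_zero_iff.mpr h1
  have h4' := norm_ne_zero_iff.mpr h4
  have h6' := norm_ne_zero_iff.mpr h6
  rw [norm_blaschkeFactor, norm_blaschkeFactor, e1, e2]
  simp only [norm_div, norm_mul, e3]
  field_simp

theorem norm_blaschkeFactor_sq (s u : ℂ) :
    ‖blaschkeFactor (s ^ 2) (u ^ 2)‖ = ‖blaschkeFactor s u‖ * ‖blaschkeFactor (-s) u‖ := by
  simp only [norm_blaschkeFactor, ← norm_mul, map_pow, map_neg]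
  rw [div_mul_div_comm, show s ^ 2 - u ^ 2 = -((s - u) * (-s - u)) by ring,
    show 1 - conj s ^ 2 * u ^ 2 = (1 - conj s * u) * (1 - -conj s * u) by ring, neg_div, norm_neg]

theorem norm_phiMap_lt_one {α : ℝ} (hα : |α| < 1) {z : ℂ} (hz : ‖z‖ < 1) : ‖phiMap α z‖ < 1 := by
  rw [phiMap_eq_mobius_sq, norm_pow]
  exact pow_lt_one₀ (norm_nonneg _) (norm_mobius_lt_one hα hz) two_ne_zero

/-- The deck transformation of the double cover `phiMap α`: the involution of the disk which
exchanges the two points of each fibre and fixes the critical point `-α`. -/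
noncomputable def sheetSwap (α : ℝ) (c : ℂ) : ℂ := mobius (-α) (-mobius α c)

section

variable {α : ℝ} (hα : |α| < 1) {c z : ℂ} (hc : ‖c‖ < 1) (hz : ‖z‖ < 1)

include hα hc

theorem norm_sheetSwap_lt_one : ‖sheetSwap α c‖ < 1 :=
  norm_mobius_lt_one (by simpa using hα) (by simpa using norm_mobius_lt_one hα hc)

theorem mobius_sheetSwap : mobius α (sheetSwap α c) = -mobius α c :=
  mobius_mobius_neg hα (by simpa using norm_mobius_lt_one hα hc)

theorem phiMap_sheetSwap : phiMap α (sheetSwap α c) = phiMap α c := by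
  rw [phiMap_eq_mobius_sq, phiMap_eq_mobius_sq, mobius_sheetSwap hα hc, neg_sq]

theorem sheetSwap_eq_self_iff : sheetSwap α c = c ↔ c = -α := by
  have h : mobius α c = 0 ↔ c = -α := by
    rw [mobius, div_eq_zero_iff, or_iff_left (one_add_ofReal_mul_ne_zero hα hc),
      add_eq_zero_iff_eq_neg]
  rw [← h]
  constructor
  · intro h1
    have h2 := mobius_sheetSwap hα hc
    rw [h1] at h2
    exact self_eq_neg.mp h2
  · intro h1
    apply mobius_inj hα (norm_sheetSwap_lt_one hα hc) hc
    rw [mobius_sheetSwap hα hc, h1, neg_zero]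

include hz

theorem phiMap_eq_phiMap_iff : phiMap α z = phiMap α c ↔ z = c ∨ z = sheetSwap α c := by
  rw [phiMap_eq_mobius_sq, phiMap_eq_mobius_sq, sq_eq_sq_iff_eq_or_eq_neg,
    ← mobius_sheetSwap hα hc]
  refine or_congr ⟨mobius_inj hα hz hc, congrArg _⟩
    ⟨mobius_inj hα hz (norm_sheetSwap_lt_one hα hc), congrArg _⟩

/-- Each Blaschke factor composed with `phiMap α` is, up to a unimodular constant, the product of
the two Blaschke factors for the points of the fibre. -/
theorem norm_blaschkeFactor_phiMap :
    ‖blaschkeFactor (phiMap α c) (phiMap α z)‖ =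
      ‖blaschkeFactor c z‖ * ‖blaschkeFactor (sheetSwap α c) z‖ := by
  rw [phiMap_eq_mobius_sq, phiMap_eq_mobius_sq, norm_blaschkeFactor_sq,
    norm_blaschkeFactor_mobius hα hc hz, ← mobius_sheetSwap hα hc,
    norm_blaschkeFactor_mobius hα (norm_sheetSwap_lt_one hα hc) hz]

end

theorem exists_phiMap_eq {α : ℝ} (hα : |α| < 1) {a : ℂ} (ha : ‖a‖ < 1) :
    ∃ c, ‖c‖ < 1 ∧ phiMap α c = a := by
  obtain ⟨s, hs⟩ := IsAlgClosed.exists_pow_nat_eq a two_pos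
  have hs1 : ‖s‖ < 1 := by
    rw [← hs, norm_pow] at ha
    exact (pow_lt_one_iff_of_nonneg (norm_nonneg _) two_ne_zero).mp ha
  exact ⟨mobius (-α) s, norm_mobius_lt_one (by simpa using hα) hs1, by
    rw [phiMap_eq_mobius_sq, mobius_mobius_neg hα hs1, hs]⟩

/-- For functions that are trivial outside the disk, the product over a fibre of `phiMap α` (taken
in all of `ℂ`) is the product over its at most two points in the disk. -/
@[to_additive /-- For functions that vanish outside the disk, the sum over a fibre of `phiMap α`
(taken in all of `ℂ`) is the sum over its at most two points in the disk. -/]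
theorem hasProd_fiber_phiMap {M : Type*} [CommMonoid M] [TopologicalSpace M] {α : ℝ}
    (hα : |α| < 1) {f : ℂ → M} (hf : ∀ b, f b ≠ 1 → ‖b‖ < 1) {c : ℂ} (hc : ‖c‖ < 1) :
    HasProd (fun b : phiMap α ⁻¹' {phiMap α c} ↦ f b) (∏ b ∈ {c, sheetSwap α c}, f b) := by
  refine hasProd_subtype_iff_mulIndicator.mpr ?_
  have h : ∏ b ∈ {c, sheetSwap α c}, f b =
      ∏ b ∈ {c, sheetSwap α c}, (phiMap α ⁻¹' {phiMap α c}).mulIndicator f b := by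
    refine Finset.prod_congr rfl fun b hb ↦ (Set.mulIndicator_of_mem ?_ f).symm
    rw [Finset.mem_insert, Finset.mem_singleton] at hb
    rcases hb with rfl | rfl
    · rfl
    · exact phiMap_sheetSwap hα hc
  rw [h]
  refine hasProd_prod_of_ne_finset_one fun b hb ↦ ?_
  by_contra hne
  have hmem := Set.mem_of_mulIndicator_ne_one hne
  rw [Set.mulIndicator_of_mem hmem] at hne
  refine hb ?_
  rw [Finset.mem_insert, Finset.mem_singleton]
  exact (phiMap_eq_phiMap_iff hα hc (hf b hne)).mp hmem

/-! ### The critical orbit on the real axis -/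

/-- The restriction of `phiMap α` to the real axis. -/
noncomputable def realPhi (α x : ℝ) : ℝ := ((x + α) / (1 + α * x)) ^ 2

/-- The forward orbit of the critical value `0`, as a sequence of real numbers. -/
noncomputable def critOrbit (α : ℝ) (n : ℕ) : ℝ := (realPhi α)^[n] 0

theorem mobius_ofReal (α x : ℝ) : mobius α x = ((x + α) / (1 + α * x) : ℝ) := by
  simp [mobius]

theorem phiMap_ofReal (α x : ℝ) : phiMap α x = (realPhi α x : ℝ) := by
  simp [phiMap, realPhi]

theorem iterate_phiMap_ofReal (α x : ℝ) (n : ℕ) :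
    (phiMap α)^[n] x = ((realPhi α)^[n] x : ℝ) :=
  ((Function.Semiconj.iterate_right (f := ((↑) : ℝ → ℂ)) (ga := realPhi α)
    (fun x ↦ (phiMap_ofReal α x).symm) n) x).symm

theorem iterate_phiMap_zero (α : ℝ) (n : ℕ) : (phiMap α)^[n] 0 = (critOrbit α n : ℝ) := by
  rw [← Complex.ofReal_zero, iterate_phiMap_ofReal, critOrbit]

theorem critOrbit_zero (α : ℝ) : critOrbit α 0 = 0 := rfl

theorem critOrbit_succ (α : ℝ) (n : ℕ) : critOrbit α (n + 1) = realPhi α (critOrbit α n) :=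
  Function.iterate_succ_apply' _ _ _

theorem realPhi_mem_Ico {α : ℝ} (h0 : 0 < α) (h1 : α < 1) {x : ℝ} (hx : x ∈ Set.Ico 0 1) :
    realPhi α x ∈ Set.Ico 0 1 := by
  obtain ⟨hx0, hx1⟩ := hx
  refine ⟨sq_nonneg _, ?_⟩
  have hd : 0 < 1 + α * x := by positivity
  refine pow_lt_one₀ (by positivity) ?_ two_ne_zero
  rw [div_lt_one hd]
  nlinarith

theorem realPhi_strictMonoOn {α : ℝ} (h0 : 0 < α) (h1 : α < 1) :
    StrictMonoOn (realPhi α) (Set.Ico 0 1) := by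
  intro x hx y hy hxy
  have hx0 := hx.1
  have hy0 := hy.1
  refine pow_lt_pow_left₀ ?_ (by positivity) two_ne_zero
  rw [div_lt_div_iff₀ (by positivity) (by positivity)]
  nlinarith [mul_pos (sub_pos.mpr hxy) (show 0 < 1 - α ^ 2 by nlinarith)]

/-- The contraction towards the fixed point `1`. The factor `(1 + α) / (4 α)` is less than `1`
exactly when `1 / 3 < α`, and the bound is an instance of the inequality between the arithmetic
and the geometric mean. -/
theorem one_sub_realPhi_le {α : ℝ} (h0 : 0 < α) (h1 : α < 1) {x : ℝ} (hx : x ∈ Set.Ico 0 1) :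
    1 - realPhi α x ≤ (1 + α) / (4 * α) * (1 - x) := by
  obtain ⟨hx0, hx1⟩ := hx
  have hd : 0 < 1 + α * x := by positivity
  have e : 1 - realPhi α x = (1 + α) * ((1 - α) * (1 + x)) * (1 - x) / (1 + α * x) ^ 2 := by
    rw [realPhi, div_pow, one_sub_div (by positivity)]
    congr 1; ring
  have key : 4 * α * ((1 - α) * (1 + x)) ≤ (1 + α * x) ^ 2 := by
    nlinarith [sq_nonneg ((1 - α) - α * (1 + x))]
  rw [e, div_mul_eq_mul_div, div_le_div_iff₀ (by positivity) (by positivity)]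
  have : 0 ≤ (1 + α) * (1 - x) := mul_nonneg (by linarith) (by linarith)
  nlinarith [mul_le_mul_of_nonneg_left key this]

theorem critOrbit_mem_Ico {α : ℝ} (h0 : 0 < α) (h1 : α < 1) (n : ℕ) :
    critOrbit α n ∈ Set.Ico 0 1 := by
  induction n with
  | zero => simp [critOrbit_zero]
  | succ n ih => rw [critOrbit_succ]; exact realPhi_mem_Ico h0 h1 ih

theorem iterate_realPhi_strictMonoOn {α : ℝ} (h0 : 0 < α) (h1 : α < 1) (n : ℕ) :
    StrictMonoOn (realPhi α)^[n] (Set.Ico 0 1) := by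
  induction n with
  | zero => exact fun _ _ _ _ h ↦ h
  | succ n ih => exact ih.comp (realPhi_strictMonoOn h0 h1) fun _ ↦ realPhi_mem_Ico h0 h1

theorem iterate_realPhi_critOrbit (α : ℝ) (n k : ℕ) :
    (realPhi α)^[n] (critOrbit α k) = critOrbit α (n + k) :=
  (Function.iterate_add_apply _ _ _ _).symm

theorem critOrbit_strictMono {α : ℝ} (h0 : 0 < α) (h1 : α < 1) : StrictMono (critOrbit α) := by
  refine strictMono_nat_of_lt_succ fun n ↦ ?_
  have h : critOrbit α 0 < critOrbit α 1 := by
    rw [critOrbit_succ, critOrbit_zero, realPhi]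
    simp only [zero_add, mul_zero, add_zero, div_one]
    positivity
  simpa only [iterate_realPhi_critOrbit, add_zero] using
    iterate_realPhi_strictMonoOn h0 h1 n (critOrbit_mem_Ico h0 h1 0) (critOrbit_mem_Ico h0 h1 1) h

theorem one_sub_critOrbit_le {α : ℝ} (h0 : 0 < α) (h1 : α < 1) (n : ℕ) :
    1 - critOrbit α n ≤ ((1 + α) / (4 * α)) ^ n := by
  induction n with
  | zero => simp [critOrbit_zero]
  | succ n ih =>
    rw [critOrbit_succ, pow_succ']
    exact (one_sub_realPhi_le h0 h1 (critOrbit_mem_Ico h0 h1 n)).trans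
      (mul_le_mul_of_nonneg_left ih (by positivity))

/-- The preimage under `phiMap α` of the `n`-th point of the critical orbit which lies in
`(-1, -α]`. For `n = 0` it is the critical point itself, and for `n > 0` it is the preimage that
does not belong to the critical orbit. -/
noncomputable def sidePreimage (α : ℝ) (n : ℕ) : ℝ :=
  -((√(critOrbit α n) + α) / (1 + α * √(critOrbit α n)))

theorem ofReal_sidePreimage (α : ℝ) (n : ℕ) :
    (sidePreimage α n : ℂ) = mobius (-α) (-(√(critOrbit α n) : ℝ)) := by
  rw [← Complex.ofReal_neg, mobius_ofReal, sidePreimage, ← neg_div]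
  congr 2 <;> ring

theorem sidePreimage_le {α : ℝ} (h0 : 0 < α) (h1 : α < 1) (n : ℕ) : sidePreimage α n ≤ -α := by
  have hs := Real.sqrt_nonneg (critOrbit α n)
  rw [sidePreimage, neg_le_neg_iff, le_div_iff₀ (by positivity)]
  nlinarith [mul_nonneg hs (show 0 ≤ 1 - α ^ 2 by nlinarith)]

theorem neg_one_lt_sidePreimage {α : ℝ} (h0 : 0 < α) (h1 : α < 1) (n : ℕ) :
    -1 < sidePreimage α n := by
  have hs := Real.sqrt_nonneg (critOrbit α n)
  have hs1 : √(critOrbit α n) < 1 := by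
    rw [Real.sqrt_lt' one_pos, one_pow]; exact (critOrbit_mem_Ico h0 h1 n).2
  rw [sidePreimage, neg_lt_neg_iff, div_lt_one (by positivity)]
  nlinarith

theorem one_sub_sidePreimage_sq_le {α : ℝ} (h0 : 0 < α) (h1 : α < 1) (n : ℕ) :
    1 - sidePreimage α n ^ 2 ≤ 1 - critOrbit α n := by
  have hw := critOrbit_mem_Ico h0 h1 n
  have hs := Real.sqrt_nonneg (critOrbit α n)
  have hsq := Real.sq_sqrt hw.1
  have hd : 0 < 1 + α * √(critOrbit α n) := by positivity
  rw [sidePreimage, neg_sq, div_pow, one_sub_div (by positivity), div_le_iff₀ (by positivity)]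
  have e : (1 + α * √(critOrbit α n)) ^ 2 - (√(critOrbit α n) + α) ^ 2 =
      (1 - critOrbit α n) * (1 - α ^ 2) := by
    linear_combination (α ^ 2 - 1) * hsq
  rw [e]
  refine mul_le_mul_of_nonneg_left ?_ (by linarith [hw.2])
  nlinarith [mul_nonneg h0.le hs]

/-! ### The Blaschke condition for the grand orbit -/

/-- A point whose orbit meets the critical orbit either belongs to the critical orbit or has some
`sidePreimage α k` in its forward orbit: the latter is where it enters the critical orbit. -/
theorem mem_critOrbit_or_reaches_sidePreimage {α : ℝ} (h0 : 0 < α) (h1 : α < 1) {n m : ℕ} {z : ℂ}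
    (hz : ‖z‖ < 1) (h : (phiMap α)^[n] z = (phiMap α)^[m] 0) :
    (∃ k, z = critOrbit α k) ∨ ∃ j k, (phiMap α)^[j] z = sidePreimage α k := by
  have hα : |α| < 1 := by rwa [abs_of_pos h0]
  induction n generalizing z with
  | zero => exact Or.inl ⟨m, by rw [← iterate_phiMap_zero, ← h]; rfl⟩
  | succ n ih =>
    rw [Function.iterate_succ_apply] at h
    rcases ih (norm_phiMap_lt_one hα hz) h with ⟨k, hk⟩ | ⟨j, k, hjk⟩
    · have hw := critOrbit_mem_Ico h0 h1 k
      have hs : ((√(critOrbit α k) : ℝ) : ℂ) ^ 2 = critOrbit α k := by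
        exact_mod_cast Real.sq_sqrt hw.1
      rw [phiMap_eq_mobius_sq, ← hs, sq_eq_sq_iff_eq_or_eq_neg] at hk
      have hside : mobius α z = -(√(critOrbit α k) : ℝ) → z = sidePreimage α k := fun h ↦ by
        rw [ofReal_sidePreimage, ← h, mobius_neg_mobius hα hz]
      rcases hk with hk | hk
      · cases k with
        | zero => exact Or.inr ⟨0, 0, hside (by rw [hk]; simp [critOrbit_zero])⟩
        | succ k =>
          left
          have hk0 := critOrbit_mem_Ico h0 h1 k
          refine ⟨k, mobius_inj hα hz ?_ ?_⟩
          · rw [Complex.norm_real, Real.norm_of_nonneg hk0.1]; exact hk0.2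
          · have := hk0.1
            rw [hk, mobius_ofReal, critOrbit_succ, realPhi, Real.sqrt_sq (by positivity)]
      · exact Or.inr ⟨0, k, hside hk⟩
    · exact Or.inr ⟨j + 1, k, by rwa [Function.iterate_succ_apply]⟩

/-- The Green potential at `z` of the points of `S` in the disk, each with weight `1`. A point of
`S` at `z` itself contributes `0`, because `Real.log 0 = 0`. -/
noncomputable def greenPotential (S : Set ℂ) (z : ℂ) : ℝ≥0∞ :=
  ∑' c, (S ∩ Metric.ball 0 1).indicator (fun c ↦ ENNReal.ofReal (-Real.log ‖blaschkeFactor c z‖)) c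

/-- Passing to preimages under `phiMap α` does not increase the Green potential, because the two
points of a fibre together contribute as much as their image; a double point is counted once. -/
theorem greenPotential_preimage_le {α : ℝ} (hα : |α| < 1) {S : Set ℂ} {z : ℂ} (hz : ‖z‖ < 1)
    (hS : phiMap α z ∉ S) :
    greenPotential (phiMap α ⁻¹' S) z ≤ greenPotential S (phiMap α z) := by
  classical
  rw [greenPotential, ← ENNReal.tsum_fiberwise _ (phiMap α), greenPotential]
  refine ENNReal.tsum_le_tsum fun a ↦ ?_
  by_cases ha : a ∈ S ∩ Metric.ball 0 1
  · obtain ⟨c, hc, rfl⟩ := exists_phiMap_eq hα (mem_ball_zero_iff.mp ha.2)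
    set f := (phiMap α ⁻¹' S ∩ Metric.ball 0 1).indicator
      (fun c ↦ ENNReal.ofReal (-Real.log ‖blaschkeFactor c z‖)) with hf
    have hc' := norm_sheetSwap_lt_one hα hc
    have hfc : f c = ENNReal.ofReal (-Real.log ‖blaschkeFactor c z‖) :=
      Set.indicator_of_mem (show c ∈ phiMap α ⁻¹' S ∩ Metric.ball 0 1 from
        ⟨ha.1, mem_ball_zero_iff.mpr hc⟩) _
    have hfc' : f (sheetSwap α c) =
        ENNReal.ofReal (-Real.log ‖blaschkeFactor (sheetSwap α c) z‖) :=
      Set.indicator_of_mem (show sheetSwap α c ∈ phiMap α ⁻¹' S ∩ Metric.ball 0 1 from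
        ⟨by rw [Set.mem_preimage, phiMap_sheetSwap hα hc]; exact ha.1,
          mem_ball_zero_iff.mpr hc'⟩) _
    have hsupp : ∀ b, f b ≠ 0 → ‖b‖ < 1 := fun b hb ↦
      mem_ball_zero_iff.mp (Set.mem_of_indicator_ne_zero hb).2
    have hne : ‖blaschkeFactor (phiMap α c) (phiMap α z)‖ ≠ 0 := by
      rw [norm_ne_zero_iff, Ne, blaschkeFactor_eq_zero_iff (norm_phiMap_lt_one hα hc)
        (norm_phiMap_lt_one hα hz)]
      exact fun h ↦ hS (h ▸ ha.1)
    rw [norm_blaschkeFactor_phiMap hα hc hz, mul_ne_zero_iff] at hne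
    rw [(hasSum_fiber_phiMap hα hsupp hc).tsum_eq, Set.indicator_of_mem ha,
      norm_blaschkeFactor_phiMap hα hc hz, Real.log_mul hne.1 hne.2, neg_add,
      ENNReal.ofReal_add
        (neg_nonneg.mpr (Real.log_nonpos (norm_nonneg _) (norm_blaschkeFactor_lt_one hc hz).le))
        (neg_nonneg.mpr (Real.log_nonpos (norm_nonneg _) (norm_blaschkeFactor_lt_one hc' hz).le)),
      ← hfc, ← hfc']
    by_cases heq : c = sheetSwap α c
    · rw [← heq]; simp
    · rw [Finset.sum_pair heq]
  · rw [Set.indicator_of_notMem ha]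
    refine le_of_eq (ENNReal.tsum_eq_zero.mpr fun b ↦ Set.indicator_of_notMem ?_ _)
    rintro ⟨hbS, hb⟩
    have hba : phiMap α b = a := b.2
    refine ha ⟨hba ▸ hbS, ?_⟩
    rw [mem_ball_zero_iff] at hb ⊢
    exact hba ▸ norm_phiMap_lt_one hα hb

theorem greenPotential_preimage_iterate_le {α : ℝ} (hα : |α| < 1) {S : Set ℂ} (n : ℕ) {z : ℂ}
    (hz : ‖z‖ < 1) (hS : (phiMap α)^[n] z ∉ S) :
    greenPotential ((phiMap α)^[n] ⁻¹' S) z ≤ greenPotential S ((phiMap α)^[n] z) := by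
  induction n generalizing z with
  | zero => exact le_rfl
  | succ n ih =>
    rw [Function.iterate_succ_apply] at hS ⊢
    rw [Function.iterate_succ, Set.preimage_comp]
    exact (greenPotential_preimage_le hα hz hS).trans (ih (norm_phiMap_lt_one hα hz) hS)

theorem indicator_iUnion_le_tsum {ι β : Type*} (t : ι → Set β) (f : β → ℝ≥0∞) (b : β) :
    (⋃ i, t i).indicator f b ≤ ∑' i, (t i).indicator f b := by
  by_cases hb : b ∈ ⋃ i, t i
  · obtain ⟨i, hi⟩ := Set.mem_iUnion.mp hb
    rw [Set.indicator_of_mem hb, ← Set.indicator_of_mem hi f]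
    exact ENNReal.le_tsum i
  · simp [Set.indicator_of_notMem hb]

theorem tsum_indicator_range_le {β : Type*} (y : ℕ → β) (f : β → ℝ≥0∞) :
    ∑' b, (Set.range y).indicator f b ≤ ∑' k, f (y k) := by
  classical
  calc ∑' b, (Set.range y).indicator f b
      ≤ ∑' b, ∑' k, ({y k} : Set β).indicator f b := by
        rw [← Set.iUnion_singleton_eq_range]
        exact ENNReal.tsum_le_tsum fun b ↦ indicator_iUnion_le_tsum _ _ _
    _ = ∑' k, ∑' b, ({y k} : Set β).indicator f b := ENNReal.tsum_comm
    _ = ∑' k, f (y k) := by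
        refine tsum_congr fun k ↦ ?_
        rw [← tsum_subtype, tsum_singleton]

/-- The points of the critical orbit and the points `sidePreimage α k` lie on opposite sides of the
origin, so their Green function decays like the product of their distances to the circle. -/
theorem neg_log_norm_blaschkeFactor_sidePreimage_le {α : ℝ} (h0 : 0 < α) (h1 : α < 1) (k n : ℕ) :
    -Real.log ‖blaschkeFactor (sidePreimage α k) (critOrbit α n)‖ ≤
      1 / α ^ 2 * (((1 + α) / (4 * α)) ^ k * ((1 + α) / (4 * α)) ^ n) := by
  have hw := critOrbit_mem_Ico h0 h1 n
  have hy1 := sidePreimage_le h0 h1 k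
  have hy2 := neg_one_lt_sidePreimage h0 h1 k
  have hy3 := one_sub_sidePreimage_sq_le h0 h1 k
  have hw1 := one_sub_critOrbit_le h0 h1 n
  have hw2 := one_sub_critOrbit_le h0 h1 k
  have hy : ‖(sidePreimage α k : ℂ)‖ < 1 := by
    rw [Complex.norm_real, Real.norm_eq_abs, abs_lt]; constructor <;> linarith
  have hwn : ‖(critOrbit α n : ℂ)‖ < 1 := by
    rw [Complex.norm_real, Real.norm_of_nonneg hw.1]; exact hw.2
  have hsq := one_sub_norm_blaschkeFactor_sq hy hwn
  set ρ := ‖blaschkeFactor (sidePreimage α k) (critOrbit α n)‖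
  set y := sidePreimage α k
  set w := critOrbit α n
  set q := (1 + α) / (4 * α)
  have e : ‖1 - conj (y : ℂ) * w‖ = 1 - y * w := by
    rw [Complex.conj_ofReal]
    norm_cast
    refine Real.norm_of_nonneg ?_
    nlinarith [hw.1]
  simp only [e, Complex.norm_real, Real.norm_eq_abs, sq_abs] at hsq
  have hden : 1 ≤ (1 - y * w) ^ 2 := by
    refine one_le_pow₀ ?_
    nlinarith [hw.1]
  have hy4 : 0 ≤ 1 - y ^ 2 := by nlinarith
  have hw4 : 0 ≤ 1 - w ^ 2 := by nlinarith [hw.1, hw.2]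
  have hle : 1 - ρ ^ 2 ≤ (1 - y ^ 2) * (1 - w ^ 2) := by
    rw [hsq]; exact div_le_self (mul_nonneg hy4 hw4) hden
  -- the two points stay a definite pseudo-hyperbolic distance apart, which makes `-log ρ`
  -- comparable to `1 - ρ ^ 2`
  have hρ : α ^ 2 ≤ ρ ^ 2 := by
    have : (1 - y ^ 2) * (1 - w ^ 2) ≤ 1 - α ^ 2 := by
      nlinarith [mul_nonneg hy4 (sq_nonneg w)]
    linarith
  have hα2 : 0 < α ^ 2 := by positivity
  have hρ0 : 0 < ρ ^ 2 := hα2.trans_le hρ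
  have hlog := Real.one_sub_inv_le_log_of_pos hρ0
  rw [Real.log_pow] at hlog
  push_cast at hlog
  have h2 : (ρ ^ 2)⁻¹ - 1 = (1 - ρ ^ 2) / ρ ^ 2 := by
    rw [sub_div, one_div, div_self hρ0.ne']
  have h3 : (1 - ρ ^ 2) / ρ ^ 2 ≤ (q ^ k * (2 * q ^ n)) / α ^ 2 := by
    have : (1 - y ^ 2) * (1 - w ^ 2) ≤ q ^ k * (2 * q ^ n) := by
      refine mul_le_mul (hy3.trans hw2) ?_ hw4 (by positivity)
      nlinarith [hw.1, hw.2]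
    have hpos : 0 ≤ q ^ k * (2 * q ^ n) := by positivity
    exact div_le_div₀ hpos (hle.trans this) hα2 hρ
  have h4 : 1 / α ^ 2 * (q ^ k * q ^ n) = (q ^ k * (2 * q ^ n)) / α ^ 2 / 2 := by ring
  rw [h4]
  linarith

/-- The Blaschke condition for the grand orbit without multiplicities. The critical orbit
contributes a geometric series; the preimages of the points `sidePreimage α k` under all iterates
contribute at most their Green potentials at `0`, since `1 - ‖c‖ ≤ -log ‖c‖`. -/
theorem tsum_grandOrbit_ne_top {α : ℝ} (hα : 1 / 3 < α) (h1 : α < 1) :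
    ∑' c, (grandOrbit (phiMap α) 0).indicator (fun c ↦ ENNReal.ofReal (1 - ‖c‖)) c ≠ ∞ := by
  have h0 : 0 < α := by linarith
  have habs : |α| < 1 := by rwa [abs_of_pos h0]
  set q := (1 + α) / (4 * α) with hq
  have hq0 : 0 ≤ q := by positivity
  have hq1 : q < 1 := by rw [hq, div_lt_one (by positivity)]; linarith
  set f : ℂ → ℝ≥0∞ := fun c ↦ ENNReal.ofReal (1 - ‖c‖)
  set g : ℂ → ℝ≥0∞ := fun c ↦ ENNReal.ofReal (-Real.log ‖blaschkeFactor c 0‖)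
  set W : Set ℂ := Set.range fun k ↦ (critOrbit α k : ℂ)
  set Y : Set ℂ := Set.range fun k ↦ (sidePreimage α k : ℂ)
  have hnot : ∀ n, (phiMap α)^[n] 0 ∉ Y := by
    rintro n ⟨k, hk⟩
    rw [iterate_phiMap_zero] at hk
    beta_reduce at hk
    have hk' : sidePreimage α k = critOrbit α n := by exact_mod_cast hk
    linarith [sidePreimage_le h0 h1 k, (critOrbit_mem_Ico h0 h1 n).1]
  have hpoint : ∀ c, (grandOrbit (phiMap α) 0).indicator f c ≤
      W.indicator f c + ∑' n, ((phiMap α)^[n] ⁻¹' Y ∩ Metric.ball 0 1).indicator g c := by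
    intro c
    by_cases hc : c ∈ grandOrbit (phiMap α) 0
    · obtain ⟨hcD, n, m, hnm⟩ := hc
      have hcn := mem_ball_zero_iff.mp hcD
      rw [Set.indicator_of_mem (show c ∈ grandOrbit (phiMap α) 0 from ⟨hcD, n, m, hnm⟩)]
      rcases mem_critOrbit_or_reaches_sidePreimage h0 h1 hcn hnm with ⟨k, rfl⟩ | ⟨j, k, hjk⟩
      · rw [Set.indicator_of_mem (show (critOrbit α k : ℂ) ∈ W from ⟨k, rfl⟩)]
        exact le_self_add
      · refine le_add_left (le_trans ?_ (ENNReal.le_tsum j))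
        rw [Set.indicator_of_mem (show c ∈ (phiMap α)^[j] ⁻¹' Y ∩ Metric.ball 0 1 from
          ⟨⟨k, hjk.symm⟩, hcD⟩)]
        refine ENNReal.ofReal_le_ofReal ?_
        have hc0 : c ≠ 0 := by
          rintro rfl
          exact hnot j ⟨k, hjk.symm⟩
        rw [norm_blaschkeFactor_zero_right]
        linarith [Real.log_le_sub_one_of_pos (norm_pos_iff.mpr hc0)]
    · simp [Set.indicator_of_notMem hc]
  have hgeom : ∑' n : ℕ, ENNReal.ofReal (q ^ n) ≠ ∞ :=
    (summable_geometric_of_lt_one hq0 hq1).tsum_ofReal_ne_top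
  have hW : ∑' c, W.indicator f c ≤ ∑' n : ℕ, ENNReal.ofReal (q ^ n) := by
    refine (tsum_indicator_range_le _ f).trans (ENNReal.tsum_le_tsum fun k ↦ ?_)
    refine ENNReal.ofReal_le_ofReal ?_
    rw [Complex.norm_real, Real.norm_of_nonneg (critOrbit_mem_Ico h0 h1 k).1]
    exact one_sub_critOrbit_le h0 h1 k
  have hY : ∀ n, greenPotential ((phiMap α)^[n] ⁻¹' Y) 0 ≤
      ENNReal.ofReal (1 / α ^ 2) *
        ((∑' k : ℕ, ENNReal.ofReal (q ^ k)) * ENNReal.ofReal (q ^ n)) := by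
    intro n
    refine (greenPotential_preimage_iterate_le habs n (by simp) (hnot n)).trans ?_
    rw [iterate_phiMap_zero, ← ENNReal.tsum_mul_right, ← ENNReal.tsum_mul_left]
    refine (ENNReal.tsum_le_tsum fun c ↦ ?_).trans
      ((tsum_indicator_range_le (fun k ↦ (sidePreimage α k : ℂ)) fun c ↦
        ENNReal.ofReal (-Real.log ‖blaschkeFactor c (critOrbit α n)‖)).trans
        (ENNReal.tsum_le_tsum fun k ↦ ?_))
    · exact Set.indicator_le_indicator_of_subset Set.inter_subset_left (fun _ ↦ zero_le) c
    · rw [← ENNReal.ofReal_mul (by positivity), ← ENNReal.ofReal_mul (by positivity)]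
      exact ENNReal.ofReal_le_ofReal (neg_log_norm_blaschkeFactor_sidePreimage_le h0 h1 k n)
  refine ne_top_of_le_ne_top ?_ (ENNReal.tsum_le_tsum hpoint)
  rw [ENNReal.tsum_add, ENNReal.tsum_comm]
  refine ENNReal.add_ne_top.mpr ⟨ne_top_of_le_ne_top hgeom hW,
    ne_top_of_le_ne_top ?_ (ENNReal.tsum_le_tsum hY)⟩
  rw [ENNReal.tsum_mul_left, ENNReal.tsum_mul_left]
  exact ENNReal.mul_ne_top ENNReal.ofReal_ne_top (ENNReal.mul_ne_top hgeom hgeom)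

theorem zeroMult_le_two (α : ℝ) (z : ℂ) : zeroMult α z ≤ 2 := by
  unfold zeroMult; split_ifs <;> norm_num

theorem mem_grandOrbit_of_zeroMult_ne_zero {α : ℝ} {z : ℂ} (h : zeroMult α z ≠ 0) :
    z ∈ grandOrbit (phiMap α) 0 := by
  unfold zeroMult at h
  split_ifs at h with h2 h1
  · exact h2.1
  · exact h1.1
  · exact absurd rfl h

theorem blaschkeCondition_zeroMult {α : ℝ} (hα : 1 / 3 < α) (h1 : α < 1) :
    BlaschkeCondition (zeroMult α) where
  norm_lt_one _ hz := mem_ball_zero_iff.mp (mem_grandOrbit_of_zeroMult_ne_zero hz).1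
  summable := by
    have hs := (ENNReal.summable_toReal (tsum_grandOrbit_ne_top hα h1)).mul_left 2
    refine hs.of_norm_bounded fun c ↦ ?_
    by_cases hc : zeroMult α c = 0
    · simp [hc]
    · have hmem := mem_grandOrbit_of_zeroMult_ne_zero hc
      have hn : 0 ≤ 1 - ‖c‖ := by linarith [mem_ball_zero_iff.mp hmem.1]
      rw [Set.indicator_of_mem hmem, ENNReal.toReal_ofReal hn, Real.norm_of_nonneg (by positivity)]
      gcongr
      exact_mod_cast zeroMult_le_two α c

/-! ### The multiplicity function -/

theorem phiMap_mem_grandOrbit_iff {α : ℝ} (hα : |α| < 1) {z : ℂ} (hz : ‖z‖ < 1) :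
    phiMap α z ∈ grandOrbit (phiMap α) 0 ↔ z ∈ grandOrbit (phiMap α) 0 := by
  constructor
  · rintro ⟨-, n, m, h⟩
    exact ⟨mem_ball_zero_iff.mpr hz, n + 1, m, h⟩
  · rintro ⟨-, n, m, h⟩
    refine ⟨mem_ball_zero_iff.mpr (norm_phiMap_lt_one hα hz), n, m + 1, ?_⟩
    rw [← Function.iterate_succ_apply, Function.iterate_succ_apply', h,
      Function.iterate_succ_apply']

theorem phiMap_mem_doubleZeros_iff {α : ℝ} (hα : |α| < 1) {z : ℂ} (hz : ‖z‖ < 1)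
    (hne : z ≠ -α) : phiMap α z ∈ doubleZeros α ↔ z ∈ doubleZeros α := by
  refine and_congr (phiMap_mem_grandOrbit_iff hα hz) ⟨fun ⟨n, h⟩ ↦ ⟨n + 1, h⟩, fun ⟨n, h⟩ ↦ ?_⟩
  cases n with
  | zero => exact absurd h hne
  | succ n => exact ⟨n, h⟩

theorem zeroMult_congr {α : ℝ} {z w : ℂ}
    (hg : z ∈ grandOrbit (phiMap α) 0 ↔ w ∈ grandOrbit (phiMap α) 0)
    (hd : z ∈ doubleZeros α ↔ w ∈ doubleZeros α) : zeroMult α z = zeroMult α w := by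
  unfold zeroMult simpleZeros
  by_cases h1 : w ∈ doubleZeros α
  · rw [if_pos h1, if_pos (hd.mpr h1)]
  · rw [if_neg h1, if_neg (mt hd.mp h1)]
    by_cases h2 : w ∈ grandOrbit (phiMap α) 0
    · rw [if_pos ⟨hg.mpr h2, mt hd.mp h1⟩, if_pos ⟨h2, h1⟩]
    · rw [if_neg fun h ↦ h2 (hg.mp h.1), if_neg fun h ↦ h2 h.1]

theorem zeroMult_phiMap {α : ℝ} (hα : |α| < 1) {z : ℂ} (hz : ‖z‖ < 1) (hne : z ≠ -α) :
    zeroMult α (phiMap α z) = zeroMult α z :=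
  zeroMult_congr (phiMap_mem_grandOrbit_iff hα hz) (phiMap_mem_doubleZeros_iff hα hz hne)

theorem phiMap_neg_self (α : ℝ) : phiMap α (-α) = 0 := by
  simp [phiMap]

theorem zeroMult_neg_self {α : ℝ} (hα : |α| < 1) : zeroMult α (-α) = 2 := by
  have h : (-α : ℂ) ∈ doubleZeros α :=
    ⟨⟨mem_ball_zero_iff.mpr (by simpa using hα), 1, 0, phiMap_neg_self α⟩, 0, rfl⟩
  rw [zeroMult, if_pos h]

theorem zeroMult_critOrbit {α : ℝ} (h0 : 0 < α) (h1 : α < 1) (k : ℕ) :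
    zeroMult α (critOrbit α k) = 1 := by
  have hw := critOrbit_mem_Ico h0 h1 k
  have hd : (critOrbit α k : ℂ) ∉ doubleZeros α := by
    rintro ⟨-, n, h⟩
    rw [iterate_phiMap_ofReal, iterate_realPhi_critOrbit] at h
    have h' : critOrbit α (n + k) = -α := by exact_mod_cast h
    linarith [(critOrbit_mem_Ico h0 h1 (n + k)).1]
  have hg : (critOrbit α k : ℂ) ∈ grandOrbit (phiMap α) 0 := by
    refine ⟨mem_ball_zero_iff.mpr ?_, 0, k, (iterate_phiMap_zero α k).symm⟩
    rw [Complex.norm_real, Real.norm_of_nonneg hw.1]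
    exact hw.2
  rw [zeroMult, if_neg hd, if_pos ⟨hg, hd⟩]

theorem iterate_phiMap_conj (α : ℝ) (n : ℕ) (z : ℂ) :
    (phiMap α)^[n] (conj z) = conj ((phiMap α)^[n] z) :=
  ((Function.Semiconj.iterate_right (f := starRingEnd ℂ) (ga := phiMap α) (gb := phiMap α)
    (fun z ↦ by simp [phiMap]) n) z).symm

theorem conj_mem_grandOrbit {α : ℝ} {z : ℂ} (h : z ∈ grandOrbit (phiMap α) 0) :
    conj z ∈ grandOrbit (phiMap α) 0 := by
  obtain ⟨hz, n, m, h⟩ := h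
  refine ⟨by simpa using hz, n, m, ?_⟩
  rw [iterate_phiMap_conj, h, iterate_phiMap_zero, Complex.conj_ofReal]

theorem conj_mem_doubleZeros {α : ℝ} {z : ℂ} (h : z ∈ doubleZeros α) :
    conj z ∈ doubleZeros α := by
  obtain ⟨hz, n, h⟩ := h
  exact ⟨conj_mem_grandOrbit hz, n, by rw [iterate_phiMap_conj, h]; simp⟩

theorem zeroMult_conj (α : ℝ) (z : ℂ) : zeroMult α (conj z) = zeroMult α z :=
  zeroMult_congr ⟨fun h ↦ by simpa using conj_mem_grandOrbit h, conj_mem_grandOrbit⟩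
    ⟨fun h ↦ by simpa using conj_mem_doubleZeros h, conj_mem_doubleZeros⟩

/-- Between `0` and the second iterate of `0`, the first iterate is the only zero, because the
iterates of `realPhi α` are strictly increasing on `[0, 1)`. -/
theorem zeroMult_ofReal_eq_zero {α : ℝ} (h0 : 0 < α) (h1 : α < 1) {x : ℝ} (hx0 : 0 < x)
    (hx2 : x < critOrbit α 2) (hne : x ≠ critOrbit α 1) : zeroMult α x = 0 := by
  by_contra h
  obtain ⟨-, n, m, h⟩ := mem_grandOrbit_of_zeroMult_ne_zero h
  have hx : x ∈ Set.Ico (0 : ℝ) 1 := ⟨hx0.le, hx2.trans (critOrbit_mem_Ico h0 h1 2).2⟩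
  rw [iterate_phiMap_ofReal, iterate_phiMap_zero] at h
  have h' : (realPhi α)^[n] x = critOrbit α m := by exact_mod_cast h
  have hmono := iterate_realPhi_strictMonoOn h0 h1 n
  have hlow := hmono (critOrbit_mem_Ico h0 h1 0) hx hx0
  have hup := hmono hx (critOrbit_mem_Ico h0 h1 2) hx2
  rw [iterate_realPhi_critOrbit, h'] at hlow hup
  rw [(critOrbit_strictMono h0 h1).lt_iff_lt] at hlow hup
  -- strict monotonicity of the critical orbit has turned the bounds into `n < m < n + 2`
  have hm : m = n + 1 := by omega
  rw [hm, ← iterate_realPhi_critOrbit] at h'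
  exact hne (hmono.injOn hx (critOrbit_mem_Ico h0 h1 1) h')

/-! ### The functional equation -/

/-- Composition with `phiMap α` does not change the modulus of the Blaschke product: the infinite
product is regrouped along the fibres of `phiMap α`, on which the multiplicities agree with those of
the pullback of the zeros. -/
theorem norm_blaschkeProd_phiMap {α : ℝ} (hα : 1 / 3 < α) (h1 : α < 1) {z : ℂ} (hz : ‖z‖ < 1) :
    ‖blaschkeProd (zeroMult α) (phiMap α z)‖ = ‖blaschkeProd (zeroMult α) z‖ := by
  have h0 : 0 < α := by linarith
  have habs : |α| < 1 := by rwa [abs_of_pos h0]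
  have hm := blaschkeCondition_zeroMult hα h1
  have hB := (hm.hasProd hz).norm
  have hBφ := (hm.hasProd (norm_phiMap_lt_one habs hz)).norm
  simp only [norm_pow] at hB hBφ
  refine hBφ.unique (((Equiv.sigmaFiberEquiv (phiMap α)).hasProd_iff.mpr hB).sigma fun a ↦ ?_)
  by_cases ha : ‖a‖ < 1
  · obtain ⟨c, hc, rfl⟩ := exists_phiMap_eq habs ha
    have hsupp : ∀ b, ‖blaschkeFactor b z‖ ^ zeroMult α b ≠ 1 → ‖b‖ < 1 := fun b hb ↦
      hm.norm_lt_one b fun h ↦ hb (by rw [h, pow_zero])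
    suffices e : ‖blaschkeFactor (phiMap α c) (phiMap α z)‖ ^ zeroMult α (phiMap α c) =
        ∏ b ∈ {c, sheetSwap α c}, ‖blaschkeFactor b z‖ ^ zeroMult α b by
      rw [e]
      exact hasProd_fiber_phiMap habs hsupp hc
    rw [norm_blaschkeFactor_phiMap habs hc hz]
    by_cases hca : c = -α
    -- the branch point: the fibre is a single point, counted twice by the multiplicity `2`
    · have hzero : zeroMult α 0 = 1 := by
        simpa [critOrbit_zero] using zeroMult_critOrbit h0 h1 0
      rw [(sheetSwap_eq_self_iff habs hc).mpr hca, Finset.pair_eq_singleton, Finset.prod_singleton,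
        hca, phiMap_neg_self, zeroMult_neg_self habs, hzero]
      ring
    · have hne : c ≠ sheetSwap α c := fun h ↦ hca ((sheetSwap_eq_self_iff habs hc).mp h.symm)
      have hswap : sheetSwap α c ≠ -α := by
        intro h
        have hcrit : ‖(-α : ℂ)‖ < 1 := by simpa using habs
        have hφ := phiMap_sheetSwap habs hc
        rw [h] at hφ
        rcases (phiMap_eq_phiMap_iff habs hcrit hc).mp hφ.symm with h' | h'
        · exact hca h'
        · exact hca (h'.trans ((sheetSwap_eq_self_iff habs hcrit).mpr rfl))
      rw [Finset.prod_pair hne, ← zeroMult_phiMap habs (norm_sheetSwap_lt_one habs hc) hswap,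
        phiMap_sheetSwap habs hc, ← zeroMult_phiMap habs hc hca, mul_pow]
  · have hzero : ∀ b, ¬ ‖b‖ < 1 → zeroMult α b = 0 := fun b hb ↦ by
      by_contra h
      exact hb (hm.norm_lt_one b h)
    rw [hzero a ha, pow_zero]
    refine hasProd_one.congr_fun fun b ↦ ?_
    have hb : phiMap α b = a := b.2
    have : ¬ ‖(b : ℂ)‖ < 1 := fun h ↦ ha (hb ▸ norm_phiMap_lt_one habs h)
    simp [hzero b this]

/-- Two analytic functions of equal modulus on a connected open set differ by a unimodular
constant, by the maximum modulus principle for their quotient. -/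
theorem exists_eq_const_mul_of_norm_eq {f g : ℂ → ℂ} {U : Set ℂ} (hU : IsOpen U)
    (hU' : IsPreconnected U) (hf : AnalyticOnNhd ℂ f U) (hg : AnalyticOnNhd ℂ g U)
    (h : ∀ z ∈ U, ‖f z‖ = ‖g z‖) {z₀ : ℂ} (hz₀ : z₀ ∈ U) (hne : g z₀ ≠ 0) :
    ∃ κ : ℂ, ‖κ‖ = 1 ∧ ∀ z ∈ U, f z = κ * g z := by
  have hev : ∀ᶠ z in 𝓝 z₀, z ∈ U ∧ g z ≠ 0 :=
    (hU.eventually_mem hz₀).and ((hg z₀ hz₀).continuousAt.eventually_ne hne)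
  have hnorm : ∀ z, z ∈ U ∧ g z ≠ 0 → ‖f z / g z‖ = 1 := fun z hz ↦ by
    rw [norm_div, h z hz.1, div_self (norm_ne_zero_iff.mpr hz.2)]
  have hd : ∀ᶠ z in 𝓝 z₀, DifferentiableAt ℂ (fun z ↦ f z / g z) z := by
    filter_upwards [hev] with z hz
    exact (hf z hz.1).differentiableAt.div (hg z hz.1).differentiableAt hz.2
  have hmax : IsLocalMax (norm ∘ fun z ↦ f z / g z) z₀ := by
    filter_upwards [hev] with z hz
    simp only [Function.comp_apply]
    rw [hnorm z hz, hnorm z₀ ⟨hz₀, hne⟩]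
  have hconst := Complex.eventually_eq_of_isLocalMax_norm hd hmax
  refine ⟨f z₀ / g z₀, hnorm z₀ ⟨hz₀, hne⟩, ?_⟩
  refine hf.eqOn_of_preconnected_of_eventuallyEq (analyticOnNhd_const.mul hg) hU' hz₀ ?_
  filter_upwards [hev, hconst] with z hz hc
  rw [← hc, div_mul_cancel₀ _ hz.2]

theorem blaschkeFactor_ofReal {a : ℝ} (ha : 0 < a) (x : ℝ) :
    blaschkeFactor a x = ((a - x) / (1 - a * x) : ℝ) := by
  have h : (a : ℂ) ≠ 0 := by exact_mod_cast ha.ne'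
  rw [blaschkeFactor, if_neg h, Complex.conj_ofReal, Complex.norm_real, Real.norm_of_nonneg ha.le,
    div_self h, one_mul]
  push_cast
  rfl

theorem mul_pos_of_continuousOn_of_ne_zero {r : ℝ → ℝ} {a b : ℝ} (hab : a ≤ b)
    (hr : ContinuousOn r (Set.Icc a b)) (hne : ∀ x ∈ Set.Icc a b, r x ≠ 0) : 0 < r a * r b := by
  by_contra! h
  have hmem : (0 : ℝ) ∈ Set.uIcc (r a) (r b) := by
    rw [Set.mem_uIcc]
    rcases mul_nonpos_iff.mp h with h | h
    · exact Or.inr h.symm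
    · exact Or.inl h
  rw [← Set.uIcc_of_le hab] at hr hne
  obtain ⟨x, hx, hx0⟩ := intermediate_value_uIcc hr hmem
  exact hne x hx hx0

/-- On the real axis the Blaschke product changes sign exactly once between a point of
`(0, φ 0)` and its image in `(φ 0, φ (φ 0))`, at the simple zero `φ 0`. -/
theorem exists_blaschkeProd_phiMap_eq_neg_mul {α : ℝ} (hα : 1 / 3 < α) (h1 : α < 1) :
    ∃ z : ℂ, ‖z‖ < 1 ∧ blaschkeProd (zeroMult α) z ≠ 0 ∧ ∃ t : ℝ, t < 0 ∧
      blaschkeProd (zeroMult α) (phiMap α z) = t * blaschkeProd (zeroMult α) z := by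
  have h0 : 0 < α := by linarith
  have hm := blaschkeCondition_zeroMult hα h1
  have hmono := critOrbit_strictMono h0 h1
  have hw1 := critOrbit_mem_Ico h0 h1 1
  have hw1pos : 0 < critOrbit α 1 := hmono (show 0 < 1 by norm_num)
  have hw2 := critOrbit_mem_Ico h0 h1 2
  have hc1 := zeroMult_critOrbit h0 h1 1
  have hc2 := critOrbit_succ α 1
  have hc1' := critOrbit_succ α 0
  set w := critOrbit α 1
  set x := w / 2 with hx
  have hx0 : 0 < x := by positivity
  have hxw : x < w := by linarith
  have hxI : x ∈ Set.Ico (0 : ℝ) 1 := ⟨hx0.le, hxw.trans hw1.2⟩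
  have hy1 : w < realPhi α x := by
    rw [hc1']
    exact realPhi_strictMonoOn h0 h1 (critOrbit_mem_Ico h0 h1 0) hxI hx0
  have hy2 : realPhi α x < critOrbit α 2 := by
    rw [hc2]
    exact realPhi_strictMonoOn h0 h1 hxI hw1 hxw
  set y := realPhi α x
  have hyI : y ∈ Set.Ico (0 : ℝ) 1 := ⟨by linarith, hy2.trans hw2.2⟩
  have hnorm : ∀ s ∈ Set.Ico (0 : ℝ) 1, ‖(s : ℂ)‖ < 1 := fun s hs ↦ by
    rw [Complex.norm_real, Real.norm_of_nonneg hs.1]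
    exact hs.2
  have hm' := hm.update_zero w
  set m' := Function.update (zeroMult α) w 0
  have hm'conj : ∀ a, m' (conj a) = m' a := by
    intro a
    by_cases ha : a = w
    · rw [ha, Complex.conj_ofReal]
    · have ha' : conj a ≠ w := fun h ↦ ha (by rw [← Complex.conj_conj a, h, Complex.conj_ofReal])
      simp only [m', Function.update_of_ne ha, Function.update_of_ne ha', zeroMult_conj]
  have hreal : ∀ s ∈ Set.Ico (0 : ℝ) 1,
      blaschkeProd m' s = ((blaschkeProd m' s).re : ℝ) := fun s hs ↦
    (Complex.conj_eq_iff_re.mp (hm'.conj_blaschkeProd_ofReal hm'conj (hnorm s hs))).symm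
  -- the cofactor of the zero at `w` keeps its sign on `[x, y]`
  have hpos := mul_pos_of_continuousOn_of_ne_zero (r := fun s : ℝ ↦ (blaschkeProd m' s).re)
    (hxw.trans hy1).le ?_ ?_
  rotate_left
  · refine Complex.continuous_re.comp_continuousOn
      (hm'.analyticOnNhd.continuousOn.comp Complex.continuous_ofReal.continuousOn fun s hs ↦ ?_)
    exact mem_ball_zero_iff.mpr (hnorm s ⟨hx0.le.trans hs.1, hs.2.trans_lt hyI.2⟩)
  · intro s hs hs0
    have hsI : s ∈ Set.Ico (0 : ℝ) 1 := ⟨hx0.le.trans hs.1, hs.2.trans_lt hyI.2⟩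
    refine hm'.blaschkeProd_ne_zero (hnorm s hsI) ?_ (by rw [hreal s hsI, hs0, Complex.ofReal_zero])
    by_cases hsw : s = w
    · simp [m', hsw]
    · have hsw' : (s : ℂ) ≠ w := by exact_mod_cast hsw
      simp only [m', Function.update_of_ne hsw']
      exact zeroMult_ofReal_eq_zero h0 h1 (hx0.trans_le hs.1) (hs.2.trans_lt hy2) hsw
  have hBs : ∀ s ∈ Set.Ico (0 : ℝ) 1, blaschkeProd (zeroMult α) s =
      ((w - s) / (1 - w * s) * (blaschkeProd m' s).re : ℝ) := fun s hs ↦ by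
    rw [hm.blaschkeProd_eq_mul w (hnorm s hs), hc1, pow_one, blaschkeFactor_ofReal hw1pos,
      hreal s hs, ← Complex.ofReal_mul, Complex.ofReal_re]
  have hden : ∀ s ∈ Set.Ico (0 : ℝ) 1, 0 < 1 - w * s := fun s hs ↦ by
    nlinarith [hs.1, hs.2, hw1.2]
  have hpx : 0 < (w - x) / (1 - w * x) := div_pos (by linarith) (hden x hxI)
  have hpy : (w - y) / (1 - w * y) < 0 := div_neg_of_neg_of_pos (by linarith) (hden y hyI)
  beta_reduce at hpos
  set rx := (blaschkeProd m' x).re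
  set ry := (blaschkeProd m' y).re
  set px := (w - x) / (1 - w * x)
  set py := (w - y) / (1 - w * y)
  have hrx : rx ≠ 0 := left_ne_zero_of_mul hpos.ne'
  have hne : px * rx ≠ 0 := mul_ne_zero hpx.ne' hrx
  refine ⟨x, hnorm x hxI, ?_, py * ry / (px * rx), ?_, ?_⟩
  · rw [hBs x hxI]
    exact_mod_cast hne
  · have e : py * ry / (px * rx) = py / px * (rx * ry) / rx ^ 2 := by field_simp
    rw [e]
    exact div_neg_of_neg_of_pos (mul_neg_of_neg_of_pos (div_neg_of_neg_of_pos hpy hpx) hpos)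
      (by positivity)
  · rw [phiMap_ofReal, hBs y hyI, hBs x hxI, ← Complex.ofReal_mul, div_mul_cancel₀ _ hne]

theorem analyticOnNhd_phiMap {α : ℝ} (hα : |α| < 1) :
    AnalyticOnNhd ℂ (phiMap α) (Metric.ball 0 1) := by
  intro w hw
  have h := one_add_ofReal_mul_ne_zero hα (mem_ball_zero_iff.mp hw)
  have hd : AnalyticAt ℂ (fun z ↦ (z + (α : ℂ)) / (1 + (α : ℂ) * z)) w :=
    AnalyticAt.div (by fun_prop) (by fun_prop) h
  exact hd.pow 2

theorem blaschkeProd_phiMap {α : ℝ} (hα : 1 / 3 < α) (h1 : α < 1) {z : ℂ} (hz : ‖z‖ < 1) :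
    blaschkeProd (zeroMult α) (phiMap α z) = -blaschkeProd (zeroMult α) z := by
  have habs : |α| < 1 := by rw [abs_of_pos] <;> linarith
  have hm := blaschkeCondition_zeroMult hα h1
  obtain ⟨z₀, hz₀, hne, t, ht, htB⟩ := exists_blaschkeProd_phiMap_eq_neg_mul hα h1
  have hcomp : AnalyticOnNhd ℂ (blaschkeProd (zeroMult α) ∘ phiMap α) (Metric.ball 0 1) :=
    hm.analyticOnNhd.comp (analyticOnNhd_phiMap habs) fun w hw ↦
      mem_ball_zero_iff.mpr (norm_phiMap_lt_one habs (mem_ball_zero_iff.mp hw))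
  obtain ⟨κ, hκ, h⟩ := exists_eq_const_mul_of_norm_eq Metric.isOpen_ball
    (convex_ball (0 : ℂ) 1).isPreconnected hcomp hm.analyticOnNhd
    (fun w hw ↦ norm_blaschkeProd_phiMap hα h1 (mem_ball_zero_iff.mp hw))
    (mem_ball_zero_iff.mpr hz₀) hne
  have hκt : κ = t := mul_right_cancel₀ hne 
    ((h z₀ (mem_ball_zero_iff.mpr hz₀)).symm.trans htB)
  rw [hκt, Complex.norm_real, Real.norm_of_nonpos ht.le] at hκ
  have hz' := h z (mem_ball_zero_iff.mpr hz)
  rw [Function.comp_apply] at hz'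
  rw [hz', hκt, show t = -1 by linarith]
  simp

theorem isBlaschkeProduct_phiMap {α : ℝ} (h0 : 0 < α) (h1 : α < 1) :
    IsBlaschkeProduct (Pi.single (-(α : ℂ)) 2) (phiMap α) := by
  have hsupp : ∀ a : ℂ, a ≠ -α → (Pi.single (-(α : ℂ)) 2 : ℂ → ℕ) a = 0 := fun a ha ↦ by
    simp [ha]
  refine ⟨fun a ha ↦ ?_, ?_, 1, norm_one, fun z _ ↦ ?_⟩
  · have : a = -α := by
      by_contra h
      exact ha (hsupp a h)
    rw [this, mem_ball_zero_iff, norm_neg, Complex.norm_real, Real.norm_of_nonneg h0.le]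
    exact h1
  · refine summable_of_ne_finset_zero (s := {-(α : ℂ)}) fun a ha ↦ ?_
    rw [hsupp a (by simpa using ha), Nat.cast_zero, zero_mul]
  · refine ⟨_, hasProd_single (-(α : ℂ)) fun a ha ↦ by rw [hsupp a ha, pow_zero], ?_⟩
    have hne : -(α : ℂ) ≠ 0 := by simpa using h0.ne'
    have hα : (α : ℂ) ≠ 0 := by simpa using h0.ne'
    rw [Pi.single_eq_same, one_mul, phiMap, blaschkeFactor, if_neg hne, map_neg,
      Complex.conj_ofReal, norm_neg, Complex.norm_real, Real.norm_of_nonneg h0.le, neg_div,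
      div_self hα, neg_one_mul, ← neg_div]
    congr 2 <;> ring

theorem mainTheorem5 (α : ℝ) (hα : 1 / 3 < α) (hα' : α < 1) :
    Set.MapsTo (phiMap α) (Metric.ball (0 : ℂ) 1) (Metric.ball (0 : ℂ) 1) ∧
    IsBlaschkeProduct (Pi.single (-(α : ℂ)) 2) (phiMap α) ∧
    ∃ B : ℂ → ℂ,
      IsBlaschkeProduct (zeroMult α) B ∧
      AnalyticOnNhd ℂ B (Metric.ball (0 : ℂ) 1) ∧
      (∀ z ∈ Metric.ball (0 : ℂ) 1, analyticOrderAt B z = (zeroMult α z : ℕ∞)) ∧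
      (∀ z ∈ Metric.ball (0 : ℂ) 1, B (phiMap α z) = -B z) ∧
      (∀ z ∈ Metric.ball (0 : ℂ) 1, B (phiMap α z) ^ 2 = B z ^ 2) := by
  have h0 : 0 < α := by linarith
  have habs : |α| < 1 := by rwa [abs_of_pos h0]
  have hm := blaschkeCondition_zeroMult hα hα'
  have hfe : ∀ z ∈ Metric.ball (0 : ℂ) 1,
      blaschkeProd (zeroMult α) (phiMap α z) = -blaschkeProd (zeroMult α) z := fun z hz ↦
    blaschkeProd_phiMap hα hα' (mem_ball_zero_iff.mp hz)
  refine ⟨fun z hz ↦ mem_ball_zero_iff.mpr (norm_phiMap_lt_one habs (mem_ball_zero_iff.mp hz)),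
    isBlaschkeProduct_phiMap h0 hα', blaschkeProd (zeroMult α), ⟨fun a ha ↦
      mem_ball_zero_iff.mpr (hm.norm_lt_one a ha), hm.summable, 1, norm_one, fun z hz ↦
      ⟨_, hm.hasProd (mem_ball_zero_iff.mp hz), (one_mul _).symm⟩⟩, hm.analyticOnNhd,
    fun z hz ↦ hm.analyticOrderAt_blaschkeProd (mem_ball_zero_iff.mp hz), hfe, fun z hz ↦ ?_⟩
  rw [hfe z hz, neg_sq]
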